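/- Let $X$ be an alphabet, and let $u,v\in X^+$ be such that $\langle X\mid u=v\rangle$ is an Adian presentation, i.e. neither its left graph (vertex set $X$, one edge for each relation, joining the first letters of its two sides) nor its right graph (the same with last letters) contains a cycle. Let $M=\mathrm{Inv}\langle X\mid u=v\rangle$. Suppose that $M$ is of type $(2a)$, that is: - neither of $u,v$ is a subword of the other; - each of $u$ and $v$ overlaps with itself (some nonempty proper prefix of it is also a suffix of it); - $u$ and $v$ do not overlap with each other (no nonempty prefix of one of them is a suffix of the other); - no nonempty proper subword of one of them is a proper subword of the other. The words $u,v$ are called the $R$-words. For an occurrence of an $R$-word $r$ in a word $w\in X^+$, the subgraph $\Delta$ of the Schützenberger graph $S\Gamma(w)$ of $M$ generated by this occurrence is the limit of the following sequence of graphs $\Delta_0\subseteq\Delta_1\subseteq\cdots$. The graph $\Delta_0$ is the linear automaton of $w$ (a directed path labelled by $w$). A segment (directed path) of a graph labelled by one of the $R$-words, from a vertex $p$ to a vertex $q$, is called unsaturated if the other $R$-word cannot be read from $p$ to $q$ in that graph; the elementary expansion at such a segment sews on a new path from $p$ to $q$ labelled by the other $R$-word, which creates a region, bounded by the old segment and the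 new path. The graph $\Delta_1$ is obtained from $\Delta_0$ by the elementary expansion at the given occurrence of $r$ only. For $n\ge 1$, $\Delta_{n+1}$ is obtained from $\Delta_n$ by the elementary expansions at exactly those unsaturated segments of $\Delta_n$ that start from or terminate at an interior vertex of a path sewn on at the $n$-th step. The regions created at the $n$-th step are the $n$-th generation regions of $\Delta$. A special region of $\Delta$ is a third generation region such that no edge of its boundary is an edge of the linear automaton of $w$. Then the following are equivalent: 1. there are a word $w\in X^+$ and an occurrence of an $R$-word in $w$ such that the subgraph of $S\Gamma(w)$ generated by this occurrence contains a special region; 2. there are words $x,y\in X^+$ and integers $n,m\ge 2$ such that $u\equiv x^n$ and $v\equiv y^m$ (equality of words). -/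

import Mathlib

namespace RWordGraph

/-! Words over the alphabet `X` are lists.  A positive presentation `⟨X | R⟩` is given by its
set `R` of relations, that is, of pairs of words. -/

/-- The word `x ^ n`. -/
def wordPow {X : Type*} (x : List X) (n : ℕ) : List X :=
  (List.replicate n x).flatten

/-- `(r, s)` is a relation of the presentation, read in one of its two directions. -/
def IsRelation {X : Type*} (R : Set (List X × List X)) (r s : List X) : Prop :=
  (r, s) ∈ R ∨ (s, r) ∈ R

/-- `r` is one side of a relation of the presentation. -/
def IsRWord {X : Type*} (R : Set (List X × List X)) (r : List X) : Prop :=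
  ∃ s, IsRelation R r s

/-- The undirected multigraph that has one edge for each relation `(r, s) ∈ R`, joining `f r` to
`f s`, contains a cycle, i.e. a closed path of positive length that repeats no edge.  A loop is a
cycle of length one and two parallel edges form a cycle of length two. -/
def HasCycle {X : Type*} (R : Set (List X × List X)) (f : List X → Option X) : Prop :=
  ∃ (n : ℕ) (e : ℕ → List X × List X) (x : ℕ → Option X),
    0 < n ∧ Set.InjOn e (Set.Iio n) ∧ x n = x 0 ∧
      ∀ i < n, e i ∈ R ∧ s(x i, x (i + 1)) = s(f (e i).1, f (e i).2)

/-- Adian presentations: all the words in the relations are nonempty, and neither the left graph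
(which joins first letters) nor the right graph (which joins last letters) contains a cycle. -/
structure IsAdian {X : Type*} (R : Set (List X × List X)) : Prop where
  positive : ∀ ρ ∈ R, ρ.1 ≠ [] ∧ ρ.2 ≠ []
  left : ¬ HasCycle R List.head?
  right : ¬ HasCycle R List.getLast?

/-- `t` overlaps with itself: some nonempty proper prefix of `t` is also a suffix of `t`. -/
def SelfOverlaps {X : Type*} (t : List X) : Prop :=
  ∃ p, p ≠ [] ∧ p ≠ t ∧ p <+: t ∧ p <:+ t

/-- `s` and `t` overlap with each other: a nonempty prefix of one of them is a suffix of the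
other. -/
def Overlaps {X : Type*} (s t : List X) : Prop :=
  ∃ p, p ≠ [] ∧ ((p <+: s ∧ p <:+ t) ∨ (p <+: t ∧ p <:+ s))

/-- `p` is a (nonempty) proper subword of `t`. -/
def IsProperSubword {X : Type*} (p t : List X) : Prop :=
  p ≠ [] ∧ p ≠ t ∧ p <:+: t

/-- The one-relation presentation `⟨X | u = v⟩` is of type (2): neither word is a subword of the
other one, both words overlap with themselves, and they do not overlap with each other. -/
structure IsType2 {X : Type*} (u v : List X) : Prop where
  not_infix_left : ¬ u <:+: v
  not_infix_right : ¬ v <:+: u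
  self_left : SelfOverlaps u
  self_right : SelfOverlaps v
  not_overlaps : ¬ Overlaps u v

/-- Type (2a): type (2), and no proper subword of one word is a proper subword of the other. -/
structure IsType2a {X : Type*} (u v : List X) : Prop extends IsType2 u v where
  no_common : ∀ p, ¬ (IsProperSubword p u ∧ IsProperSubword p v)

/-- Vertices of the graphs built below: `base k` is the `k`-th vertex of the linear automaton, and
`inner p q s k` is the `k`-th vertex (`0 < k < |s|`) of the segment labelled by `s` that is sewn on
from `p` to `q`.  A segment `s` is sewn on from `p` to `q` only if `s` cannot be read from `p` to
`q`, so this happens at most once, and its interior vertices are always new. -/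
inductive Vertex (X : Type*) where
  | base (k : ℕ) : Vertex X
  | inner (p q : Vertex X) (s : List X) (k : ℕ) : Vertex X

/-- A labelled directed edge. -/
structure Edge (X : Type*) where
  src : Vertex X
  lbl : X
  tgt : Vertex X

/-! An inverse word graph is given by the set of its positively labelled edges `(p, x, q)`; the
inverse edges `(q, x⁻¹, p)` are determined by these.  All segments below have positive labels. -/

/-- The edges of the linear automaton of `w`. -/
def linearGraph {X : Type*} (w : List X) : Set (Edge X) :=
  {e | ∃ (k : ℕ) (h : k < w.length), e = ⟨.base k, w[k], .base (k + 1)⟩}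

/-- `l` is the list of edges of a segment (directed path) of `E` from `p` to `q`. -/
def IsSegment {X : Type*} (E : Set (Edge X)) : Vertex X → List (Edge X) → Vertex X → Prop
  | p, [], q => p = q
  | p, e :: l, q => e ∈ E ∧ e.src = p ∧ IsSegment E e.tgt l q

/-- The label of a segment. -/
def label {X : Type*} (l : List (Edge X)) : List X :=
  l.map Edge.lbl

/-- The word `t` can be read in `E` from `p` to `q`. -/
def CanRead {X : Type*} (E : Set (Edge X)) (p : Vertex X) (t : List X) (q : Vertex X) : Prop :=
  ∃ l, IsSegment E p l q ∧ label l = t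

/-- The `k`-th vertex, `0 ≤ k ≤ |s|`, of the segment labelled by `s` sewn on from `p` to `q`. -/
def sewnVertex {X : Type*} (p q : Vertex X) (s : List X) (k : ℕ) : Vertex X :=
  if k = 0 then p else if k = s.length then q else .inner p q s k

/-- The region that arises when a segment labelled by `newLabel` is sewn on from the initial
vertex `src` to the terminal vertex `tgt` of the segment `oldSide`. -/
structure Region (X : Type*) where
  src : Vertex X
  tgt : Vertex X
  oldSide : List (Edge X)
  newLabel : List X

/-- The edges of the segment sewn on. -/
def Region.newSide {X : Type*} (ρ : Region X) : Set (Edge X) :=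
  {e | ∃ (k : ℕ) (h : k < ρ.newLabel.length),
    e = ⟨sewnVertex ρ.src ρ.tgt ρ.newLabel k, ρ.newLabel[k],
      sewnVertex ρ.src ρ.tgt ρ.newLabel (k + 1)⟩}

/-- The interior vertices of the segment sewn on. -/
def Region.newInterior {X : Type*} (ρ : Region X) : Set (Vertex X) :=
  {p | ∃ k : ℕ, 0 < k ∧ k < ρ.newLabel.length ∧ p = sewnVertex ρ.src ρ.tgt ρ.newLabel k}

/-- The edges on the boundary of the region. -/
def Region.boundary {X : Type*} (ρ : Region X) : Set (Edge X) :=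
  {e | e ∈ ρ.oldSide} ∪ ρ.newSide

/-- `ρ.oldSide` is an unsaturated segment of `E`: it is labelled by one side `r` of a relation
`r = s`, where `s = ρ.newLabel` cannot be read in `E` between its end vertices.  So the elementary
expansion of `E` that creates the region `ρ` can be performed. -/
def Unsaturated {X : Type*} (R : Set (List X × List X)) (E : Set (Edge X)) (ρ : Region X) : Prop :=
  IsSegment E ρ.src ρ.oldSide ρ.tgt ∧ IsRelation R (label ρ.oldSide) ρ.newLabel ∧
    ¬ CanRead E ρ.src ρ.newLabel ρ.tgt

/-- The graph obtained from `E` by sewing on the new sides of all the regions in `S`. -/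
def sew {X : Type*} (E : Set (Edge X)) (S : Set (Region X)) : Set (Edge X) :=
  E ∪ {e | ∃ ρ ∈ S, e ∈ ρ.newSide}

/-- The iterative construction, over `⟨X | R⟩`, of the subgraph of the Schützenberger graph of
`w = a r b` generated by the displayed occurrence of the `R`-word `r`.  The first component is the
graph after `n` steps, the second one is the set of regions created at the `n`-th step.
* The construction starts with the linear automaton of `w`.
* At the first step the expansion is applied only to the displayed segment `r`.
* At each further step it is applied to exactly those unsaturated segments that start from or
  terminate at an interior vertex of a segment sewn on at the step before.
No foldings are needed, as the presentation is an Adian one and `w` is positive. -/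
def stage {X : Type*} (R : Set (List X × List X)) (a r b : List X) :
    ℕ → Set (Edge X) × Set (Region X)
  | 0 => (linearGraph (a ++ r ++ b), ∅)
  | 1 =>
    let E := linearGraph (a ++ r ++ b)
    let S := {ρ : Region X | Unsaturated R E ρ ∧ ρ.src = .base a.length ∧
      ρ.tgt = .base (a.length + r.length) ∧ label ρ.oldSide = r}
    (sew E S, S)
  | n + 2 =>
    let G := stage R a r b (n + 1)
    let S := {ρ : Region X | Unsaturated R G.1 ρ ∧
      ∃ σ ∈ G.2, ρ.src ∈ σ.newInterior ∨ ρ.tgt ∈ σ.newInterior}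
    (sew G.1 S, S)

/-- The subgraph of the Schützenberger graph of `a r b` generated by the displayed occurrence of
the `R`-word `r`: the limit of the increasing sequence of graphs constructed above. -/
def generatedSubgraph {X : Type*} (R : Set (List X × List X)) (a r b : List X) : Set (Edge X) :=
  ⋃ n, (stage R a r b n).1

/-- `ρ` is an `n`-th generation region of the subgraph generated by the displayed occurrence of
`r` in `a r b`. -/
def IsGenerationRegion {X : Type*} (R : Set (List X × List X)) (a r b : List X) (n : ℕ)
    (ρ : Region X) : Prop :=
  ρ ∈ (stage R a r b n).2 ∧ ρ.boundary ⊆ generatedSubgraph R a r b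

/-- Special regions: third generation regions that do not use an edge of the linear automaton. -/
def IsSpecialRegion {X : Type*} (R : Set (List X × List X)) (a r b : List X)
    (ρ : Region X) : Prop :=
  IsGenerationRegion R a r b 3 ρ ∧ Disjoint ρ.boundary (linearGraph (a ++ r ++ b))

end RWordGraph

/-! Both words have length at least two because they overlap with themselves, so single letters are
proper subwords, and type (2a) makes the alphabets of the two words disjoint
(`IsType2a.isDisjointPair`). Hence one letter of a segment decides which word labels it, and the
first three generations can be described completely.

Let `r` be the displayed word and `t` the other one. The first step sews on a `t`-path over `r`. A
second-step region is sewn on along a segment labelled `t` that either starts at an interior vertex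
of this path and leaves through its end (a right region), or enters through its start and ends at
such a vertex (a left region); its new side is labelled `r` (`mem_stage_two`). A third-step region
is sewn on along a segment labelled `r` that follows one of these `r`-paths to an end. At an end on
the linear automaton it would have to use an edge of that automaton, so for a special region the end
is an interior vertex of the `t`-path, and the segment continues there on the path of an opposite
region. Thus a left and a right region meet at one vertex of the `t`-path, which factors `t` into
two commuting words; the two pieces of the segment do the same for `r`
(`hasCommutingFactors_of_isSpecialRegion`). Nonempty words are products of nonempty commuting
factors exactly when they are proper powers (`hasCommutingFactors_iff`).

Conversely, commuting factorizations of both words allow a left and a right region to be built at a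
common vertex, with a special region across it (`exists_isSpecialRegion`). -/

namespace RWordGraph

variable {X : Type*}

/-! ### Commuting words and powers -/

section Words

lemma wordPow_succ (x : List X) (n : ℕ) : wordPow x (n + 1) = x ++ wordPow x n := by
  simp [wordPow, List.replicate_succ]

lemma wordPow_add (x : List X) (m n : ℕ) : wordPow x (m + n) = wordPow x m ++ wordPow x n := by
  rw [wordPow, List.replicate_add, List.flatten_append]
  rfl

lemma wordPow_one (x : List X) : wordPow x 1 = x := by
  simp [wordPow]

/-- Commuting words are powers of a common word. -/
lemma exists_wordPow_of_append_comm (s t : List X) (h : s ++ t = t ++ s) :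
    ∃ (z : List X) (i j : ℕ), s = wordPow z i ∧ t = wordPow z j := by
  induction hN : s.length + t.length using Nat.strong_induction_on generalizing s t with
  | _ N ih =>
    subst hN
    rcases eq_or_ne s [] with rfl | hs
    · exact ⟨t, 0, 1, rfl, (wordPow_one t).symm⟩
    rcases eq_or_ne t [] with rfl | ht
    · exact ⟨s, 1, 0, (wordPow_one s).symm, rfl⟩
    have hs' := List.length_pos_iff.2 hs
    have ht' := List.length_pos_iff.2 ht
    rcases le_total s.length t.length with hle | hle
    -- Euclid's algorithm: the shorter word is a prefix of the longer one, and what remains after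
    -- cancelling it still commutes with it.
    · obtain ⟨c, rfl⟩ : s <+: t :=
        List.prefix_of_prefix_length_le (List.prefix_append s t) (h ▸ List.prefix_append t s) hle
      have h' : s ++ c = c ++ s := by simpa using h
      obtain ⟨z, i, j, hi, hj⟩ := ih (s.length + c.length)
        (by simp only [List.length_append]; omega) s c h' rfl
      exact ⟨z, i, i + j, hi, by rw [wordPow_add, ← hi, ← hj]⟩
    · obtain ⟨c, rfl⟩ : t <+: s :=
        List.prefix_of_prefix_length_le (h ▸ List.prefix_append t s) (List.prefix_append s t) hle
      have h' : c ++ t = t ++ c := by simpa using h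
      obtain ⟨z, i, j, hi, hj⟩ := ih (c.length + t.length)
        (by simp only [List.length_append]; omega) c t h' rfl
      exact ⟨z, j + i, j, by rw [wordPow_add, ← hi, ← hj], hj⟩

/-- A word is the product of two nonempty commuting words. -/
def HasCommutingFactors (s : List X) : Prop :=
  ∃ x y, x ≠ [] ∧ y ≠ [] ∧ s = x ++ y ∧ s = y ++ x

lemma hasCommutingFactors_iff (s : List X) :
    HasCommutingFactors s ↔ ∃ (x : List X) (n : ℕ), x ≠ [] ∧ 2 ≤ n ∧ s = wordPow x n := by
  constructor
  · rintro ⟨x, y, hx, hy, rfl, h⟩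
    obtain ⟨z, i, j, rfl, rfl⟩ := exists_wordPow_of_append_comm x y h
    have hi : i ≠ 0 := by rintro rfl; exact hx rfl
    have hj : j ≠ 0 := by rintro rfl; exact hy rfl
    refine ⟨z, i + j, ?_, by omega, (wordPow_add z i j).symm⟩
    rintro rfl
    exact hx (by simp [wordPow])
  · rintro ⟨x, n, hx, hn, rfl⟩
    -- This form of the exponent makes both factors, `x` and the power with exponent `m + 1`,
    -- visibly nonempty.
    obtain ⟨m, rfl⟩ : ∃ m, n = 1 + (m + 1) := ⟨n - 2, by omega⟩
    refine ⟨x, wordPow x (m + 1), hx, ?_, ?_, ?_⟩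
    · rw [wordPow_succ]; simp [hx]
    · rw [wordPow_add, wordPow_one]
    · rw [add_comm 1, wordPow_add _ _ 1, wordPow_one]

/-- The lengths of the prefix `s.drop k` and the suffix `s.take k` add up to that of `s`, so
together they spell `s` in the swapped order. -/
lemma hasCommutingFactors_of_drop_prefix {s : List X} {k : ℕ} (hk : 0 < k) (hk' : k < s.length)
    (h₁ : s.drop k <+: s) (h₂ : s.take k <:+ s) : HasCommutingFactors s := by
  refine ⟨s.take k, s.drop k, ?_, ?_, (List.take_append_drop k s).symm, ?_⟩
  · rw [← List.length_pos_iff, List.length_take]; omega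
  · rw [← List.length_pos_iff, List.length_drop]; omega
  · have e₁ := List.prefix_iff_eq_take.1 h₁
    have e₂ := List.suffix_iff_eq_drop.1 h₂
    have : s.length - (s.take k).length = (s.drop k).length := by
      rw [List.length_take, List.length_drop]; omega
    rw [this] at e₂
    conv_lhs => rw [← List.take_append_drop (s.drop k).length s]
    rw [← e₁, ← e₂]

end Words

/-! ### Directed paths and their labels -/

section Segments

variable {E F : Set (Edge X)} {f : ℕ → Vertex X} {s : List X}

lemma IsSegment.mono (h : E ⊆ F) {p q : Vertex X} {l : List (Edge X)} (hl : IsSegment E p l q) :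
    IsSegment F p l q := by
  induction l generalizing p with
  | nil => exact hl
  | cons e l ih => exact ⟨h hl.1, hl.2.1, ih hl.2.2⟩

lemma isSegment_append {p q : Vertex X} {l₁ l₂ : List (Edge X)} :
    IsSegment E p (l₁ ++ l₂) q ↔ ∃ m, IsSegment E p l₁ m ∧ IsSegment E m l₂ q := by
  induction l₁ generalizing p with
  | nil => simp [IsSegment]
  | cons e l ih =>
    simp only [List.cons_append, IsSegment, ih]
    tauto

lemma IsSegment.mem {p q : Vertex X} {l : List (Edge X)} (hl : IsSegment E p l q) {e : Edge X}
    (he : e ∈ l) : e ∈ E := by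
  induction l generalizing p with
  | nil => simp at he
  | cons e' l ih =>
    rcases List.mem_cons.1 he with rfl | he
    · exact hl.1
    · exact ih hl.2.2 he

lemma length_label (l : List (Edge X)) : (label l).length = l.length := List.length_map _

lemma label_append (l₁ l₂ : List (Edge X)) : label (l₁ ++ l₂) = label l₁ ++ label l₂ :=
  List.map_append

lemma lbl_mem_label {l : List (Edge X)} {e : Edge X} (he : e ∈ l) : e.lbl ∈ label l :=
  List.mem_map_of_mem he

lemma IsSegment.exists_first {p q : Vertex X} {l : List (Edge X)} (hl : IsSegment E p l q)
    (hne : l ≠ []) : ∃ e ∈ l, e ∈ E ∧ e.src = p := by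
  cases l with
  | nil => exact absurd rfl hne
  | cons e l => exact ⟨e, List.mem_cons_self, hl.1, hl.2.1⟩

lemma IsSegment.exists_last {p q : Vertex X} {l : List (Edge X)} (hl : IsSegment E p l q)
    (hne : l ≠ []) : ∃ e ∈ l, e ∈ E ∧ e.tgt = q := by
  obtain ⟨l', e, rfl⟩ := (List.eq_nil_or_concat' l).resolve_left hne
  obtain ⟨m, -, h⟩ := isSegment_append.1 hl
  exact ⟨e, by simp, h.1, h.2.2⟩

/-- Segments from `f i` follow `f`, if the edges leaving the vertices of `f` do. -/
lemma IsSegment.follow {i : ℕ} {l : List (Edge X)} {q : Vertex X} (hl : IsSegment E (f i) l q)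
    (hf : ∀ k, i ≤ k → k < i + l.length → ∀ e ∈ E, e.src = f k → e.tgt = f (k + 1)) :
    q = f (i + l.length) := by
  induction l generalizing i with
  | nil => exact hl.symm
  | cons e l ih =>
    obtain ⟨he, hs, hl⟩ := hl
    simp only [List.length_cons] at hf
    rw [hf i le_rfl (by omega) e he hs] at hl
    rw [ih hl fun k hk hk' => hf k (by omega) (by omega)]
    simp only [List.length_cons]
    congr 1
    omega

/-- In the applications `f` runs along a sewn-on path with label `s`, whose interior vertices have
no other outgoing edges in the relevant alphabet or stage. -/
lemma IsSegment.label_prefix {i : ℕ} {l : List (Edge X)} {q : Vertex X}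
    (hl : IsSegment E (f i) l q)
    (hf : ∀ k, i ≤ k → k < i + l.length → ∀ e ∈ E, e.src = f k →
      e.tgt = f (k + 1) ∧ s[k]? = some e.lbl) :
    label l <+: s.drop i := by
  induction l generalizing i with
  | nil => exact List.nil_prefix
  | cons e l ih =>
    obtain ⟨he, hs, hl⟩ := hl
    simp only [List.length_cons] at hf
    obtain ⟨ht, hlbl⟩ := hf i le_rfl (by omega) e he hs
    rw [ht] at hl
    obtain ⟨hi, hlbl⟩ := List.getElem?_eq_some_iff.1 hlbl
    rw [List.drop_eq_getElem_cons hi, hlbl]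
    exact (List.prefix_cons_inj _).2 (ih hl fun k hk hk' => hf k (by omega) (by omega))

/-- Segments to `f j` follow `f` backwards, if the edges entering the vertices of `f` do. -/
lemma IsSegment.follow_back {j : ℕ} {l : List (Edge X)} {p : Vertex X}
    (hl : IsSegment E p l (f (j + l.length)))
    (hf : ∀ k, j ≤ k → k < j + l.length → ∀ e ∈ E, e.tgt = f (k + 1) → e.src = f k) :
    p = f j := by
  induction l using List.reverseRecOn with
  | nil => exact hl
  | append_singleton l e ih =>
    obtain ⟨m, hl, he, hs, ht⟩ := isSegment_append.1 hl
    have ht : e.tgt = f (j + (l ++ [e]).length) := ht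
    simp only [List.length_append, List.length_cons, List.length_nil, zero_add] at ht hf
    rw [← hs, hf (j + l.length) (by omega) (by omega) e he ht] at hl
    exact ih hl fun k hk hk' => hf k hk (by omega)

lemma IsSegment.label_suffix {j : ℕ} {l : List (Edge X)} {p : Vertex X}
    (hl : IsSegment E p l (f (j + l.length)))
    (hf : ∀ k, j ≤ k → k < j + l.length → ∀ e ∈ E, e.tgt = f (k + 1) →
      e.src = f k ∧ s[k]? = some e.lbl) :
    label l <:+ s.take (j + l.length) := by
  induction l using List.reverseRecOn with
  | nil => exact List.nil_suffix
  | append_singleton l e ih =>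
    obtain ⟨m, hl, he, hs, ht⟩ := isSegment_append.1 hl
    have ht : e.tgt = f (j + (l ++ [e]).length) := ht
    simp only [List.length_append, List.length_cons, List.length_nil, zero_add] at ht hf
    obtain ⟨hs', hlbl⟩ := hf (j + l.length) (by omega) (by omega) e he ht
    rw [← hs, hs'] at hl
    obtain ⟨c, hc⟩ := ih hl fun k hk hk' => hf k hk (by omega)
    refine ⟨c, ?_⟩
    rw [label_append, ← List.append_assoc, hc, List.length_append, List.length_singleton,
      ← add_assoc, List.take_add_one, hlbl]
    rfl

/-- If `E` contains the path with vertices `f` and label `s`, its subpaths are segments. -/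
lemma exists_isSegment (i d : ℕ) (h : i + d ≤ s.length)
    (hE : ∀ (k : ℕ) (hk : k < s.length), (⟨f k, s[k], f (k + 1)⟩ : Edge X) ∈ E) :
    ∃ l, IsSegment E (f i) l (f (i + d)) ∧ label l = (s.drop i).take d ∧
      ∀ e ∈ l, ∃ k, i ≤ k ∧ k < i + d ∧ e.src = f k := by
  induction d generalizing i with
  | zero => exact ⟨[], rfl, by simp [label], by simp⟩
  | succ d ih =>
    obtain ⟨l, hl, hlab, hsrc⟩ := ih (i + 1) (by omega)
    have hi : i < s.length := by omega
    refine ⟨⟨f i, s[i], f (i + 1)⟩ :: l, ⟨hE i hi, rfl, ?_⟩, ?_, ?_⟩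
    · rwa [show i + (d + 1) = i + 1 + d by omega]
    · rw [List.drop_eq_getElem_cons hi, List.take_succ_cons, ← hlab]
      rfl
    · intro e he
      rcases List.mem_cons.1 he with rfl | he
      · exact ⟨i, le_rfl, by omega, rfl⟩
      · obtain ⟨k, hk, hk', h⟩ := hsrc e he
        exact ⟨k, by omega, by omega, h⟩

end Segments

/-! ### Vertices of a sewn-on path -/

section SewnVertex

variable {p q : Vertex X} {s : List X} {k : ℕ}

lemma sewnVertex_zero : sewnVertex p q s 0 = p := if_pos rfl

lemma sewnVertex_length (hs : s ≠ []) : sewnVertex p q s s.length = q := by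
  simp [sewnVertex, hs]

lemma sewnVertex_interior (hk : 0 < k) (hk' : k < s.length) :
    sewnVertex p q s k = .inner p q s k := by
  rw [sewnVertex, if_neg hk.ne', if_neg hk'.ne]

lemma sewnVertex_source_cases (hk : k < s.length) :
    (k = 0 ∧ sewnVertex p q s k = p) ∨ (0 < k ∧ sewnVertex p q s k = .inner p q s k) := by
  rcases Nat.eq_zero_or_pos k with rfl | h
  · exact .inl ⟨rfl, sewnVertex_zero⟩
  · exact .inr ⟨h, sewnVertex_interior h hk⟩

lemma sewnVertex_target_cases (hk : k < s.length) :
    (k + 1 = s.length ∧ sewnVertex p q s (k + 1) = q) ∨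
      (k + 1 < s.length ∧ sewnVertex p q s (k + 1) = .inner p q s (k + 1)) := by
  rcases Nat.lt_or_ge (k + 1) s.length with h | h
  · exact .inr ⟨h, sewnVertex_interior (by omega) h⟩
  · have h : k + 1 = s.length := by omega
    exact .inl ⟨h, by rw [h]; exact sewnVertex_length (by rintro rfl; simp at hk)⟩

end SewnVertex

/-- The relations of `R` are `r = t` and `t = r`, and no letter occurs in both of the nonempty
words `r` and `t`. -/
structure IsDisjointPair (R : Set (List X × List X)) (r t : List X) : Prop where
  rel : ∀ p q, IsRelation R p q ↔ (p = r ∧ q = t) ∨ (p = t ∧ q = r)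
  disj : ∀ x ∈ r, x ∉ t
  left_ne : r ≠ []
  right_ne : t ≠ []

lemma IsDisjointPair.ne {R : Set (List X × List X)} {r t : List X} (H : IsDisjointPair R r t) :
    r ≠ t := by
  rintro rfl
  obtain ⟨x, hx⟩ := List.exists_mem_of_ne_nil r H.left_ne
  exact H.disj x hx hx

lemma IsDisjointPair.right_ne_left {R : Set (List X × List X)} {r t : List X}
    (H : IsDisjointPair R r t) : t ≠ r := H.ne.symm

lemma IsDisjointPair.symm {R : Set (List X × List X)} {r t : List X} (H : IsDisjointPair R r t) :
    IsDisjointPair R t r :=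
  ⟨fun p q => by rw [H.rel, or_comm], fun x hx hx' => H.disj x hx' hx, H.right_ne, H.left_ne⟩

/-! ### The graph after the first step -/

section Stages

variable {R : Set (List X × List X)} {a r b t : List X}

/-- The edges of the segment sewn on at the first step. -/
lemma mem_stage_one (H : IsDisjointPair R r t) {σ : Region X} (hσ : σ ∈ (stage R a r b 1).2) :
    σ.src = .base a.length ∧ σ.tgt = .base (a.length + r.length) ∧ σ.newLabel = t := by
  obtain ⟨⟨-, hrel, -⟩, hs, ht, hl⟩ := hσ
  refine ⟨hs, ht, ?_⟩
  rw [hl, H.rel] at hrel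
  rcases hrel with h | h
  · exact h.2
  · exact absurd h.1 H.ne

lemma mem_stage_one_edges (H : IsDisjointPair R r t) {e : Edge X}
    (he : e ∈ (stage R a r b 1).1) :
    e ∈ linearGraph (a ++ r ++ b) ∨ ∃ (k : ℕ) (h : k < t.length),
      e = ⟨sewnVertex (.base a.length) (.base (a.length + r.length)) t k, t[k],
        sewnVertex (.base a.length) (.base (a.length + r.length)) t (k + 1)⟩ := by
  rcases he with he | ⟨σ, hσ, he⟩
  · exact .inl he
  · obtain ⟨hs, ht, hl⟩ := mem_stage_one H hσ
    obtain ⟨k, hk, rfl⟩ := he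
    subst hl
    exact .inr ⟨k, hk, by rw [hs, ht]⟩

/-- Interior vertices of the sewn-on path are new, so nothing branches off there yet. -/
lemma stage_one_of_src_inner (H : IsDisjointPair R r t) {e : Edge X}
    (he : e ∈ (stage R a r b 1).1) {k : ℕ}
    (hs : e.src = .inner (.base a.length) (.base (a.length + r.length)) t k) :
    e.tgt = sewnVertex (.base a.length) (.base (a.length + r.length)) t (k + 1) ∧
      t[k]? = some e.lbl := by
  rcases mem_stage_one_edges H he with ⟨j, hj, rfl⟩ | ⟨j, hj, rfl⟩
  · cases hs
  · rcases sewnVertex_source_cases (p := .base a.length) (q := .base (a.length + r.length)) hj with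
      ⟨-, h⟩ | ⟨-, h⟩
    · cases h.symm.trans hs
    · cases h.symm.trans hs
      exact ⟨rfl, List.getElem?_eq_getElem hj⟩

lemma stage_one_of_tgt_inner (H : IsDisjointPair R r t) {e : Edge X}
    (he : e ∈ (stage R a r b 1).1) {k : ℕ}
    (hs : e.tgt = .inner (.base a.length) (.base (a.length + r.length)) t (k + 1)) :
    e.src = sewnVertex (.base a.length) (.base (a.length + r.length)) t k ∧
      t[k]? = some e.lbl := by
  rcases mem_stage_one_edges H he with ⟨j, hj, rfl⟩ | ⟨j, hj, rfl⟩
  · cases hs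
  · rcases sewnVertex_target_cases (p := .base a.length) (q := .base (a.length + r.length)) hj with
      ⟨-, h⟩ | ⟨-, h⟩
    · cases h.symm.trans hs
    · cases h.symm.trans hs
      exact ⟨rfl, List.getElem?_eq_getElem hj⟩

/-- The `t`-path leaves the linear automaton only at `base a.length`, which the strict inequality
excludes. -/
lemma stage_one_of_src_base (H : IsDisjointPair R r t) {e : Edge X}
    (he : e ∈ (stage R a r b 1).1) {j : ℕ} (hj : a.length < j) (hs : e.src = .base j) :
    e.tgt = .base (j + 1) := by
  rcases mem_stage_one_edges H he with ⟨i, hi, rfl⟩ | ⟨i, hi, rfl⟩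
  · cases hs; rfl
  · rcases sewnVertex_source_cases (p := .base a.length) (q := .base (a.length + r.length)) hi with
      ⟨-, h⟩ | ⟨-, h⟩
    · cases h.symm.trans hs; omega
    · cases h.symm.trans hs

lemma stage_one_of_tgt_base (H : IsDisjointPair R r t) {e : Edge X}
    (he : e ∈ (stage R a r b 1).1) {j : ℕ} (hj : j < a.length + r.length) (hs : e.tgt = .base j) :
    ∃ i, j = i + 1 ∧ e.src = .base i := by
  rcases mem_stage_one_edges H he with ⟨i, hi, rfl⟩ | ⟨i, hi, rfl⟩
  · cases hs; exact ⟨i, rfl, rfl⟩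
  · rcases sewnVertex_target_cases (p := .base a.length) (q := .base (a.length + r.length)) hi with
      ⟨-, h⟩ | ⟨-, h⟩
    · cases h.symm.trans hs; omega
    · cases h.symm.trans hs

/-- The induction also produces the index of the starting vertex: a path going backwards cannot run
past `base 0`. -/
lemma exists_src_base_of_tgt_base (H : IsDisjointPair R r t) {l : List (Edge X)} {p : Vertex X}
    {j : ℕ} (hj : j < a.length + r.length)
    (hl : IsSegment (stage R a r b 1).1 p l (.base j)) :
    ∃ i, j = i + l.length ∧ p = .base i := by
  induction l using List.reverseRecOn generalizing j with
  | nil => exact ⟨j, rfl, hl⟩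
  | append_singleton l e ih =>
    obtain ⟨m, hl', he, hs, ht⟩ := isSegment_append.1 hl
    obtain ⟨i, rfl, hi⟩ := stage_one_of_tgt_base H he hj ht
    rw [← hs, hi] at hl'
    obtain ⟨i', rfl, h⟩ := ih (by omega) hl'
    exact ⟨i', by simp [add_assoc], h⟩

/-! ### Second generation regions -/

/-- The regions created at the second step start at an interior vertex of the segment sewn on at
the first step and end behind the displayed occurrence of `r`. -/
def IsRightRegion (a r t : List X) (σ : Region X) (k : ℕ) : Prop :=
  0 < k ∧ k < t.length ∧
    σ.src = .inner (.base a.length) (.base (a.length + r.length)) t k ∧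
    (∃ j, a.length + r.length ≤ j ∧ σ.tgt = .base j) ∧ t.drop k <+: t

/-- The regions created at the second step end at an interior vertex of the segment sewn on at
the first step and start before the displayed occurrence of `r`. -/
def IsLeftRegion (a r t : List X) (σ : Region X) (k : ℕ) : Prop :=
  0 < k ∧ k < t.length ∧
    σ.tgt = .inner (.base a.length) (.base (a.length + r.length)) t k ∧
    (∃ j, j ≤ a.length ∧ σ.src = .base j) ∧ t.take k <:+ t

/-- The edge of the old side at the interior vertex carries a letter of `t`, so the old side is
labelled `t`. It must follow the sewn-on path to an end, reading `t.drop k` or `t.take k`, and the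
rest of it stays on the linear automaton. This gives the overlap of `t` with itself. -/
lemma mem_stage_two (H : IsDisjointPair R r t) {σ : Region X} (hσ : σ ∈ (stage R a r b 2).2) :
    σ.newLabel = r ∧ ∃ k, IsRightRegion a r t σ k ∨ IsLeftRegion a r t σ k := by
  obtain ⟨⟨hseg, hrel, -⟩, τ, hτ, hint⟩ := hσ
  have hseg : IsSegment (stage R a r b 1).1 σ.src σ.oldSide σ.tgt := hseg
  obtain ⟨hs, ht, hl⟩ := mem_stage_one H (hτ : τ ∈ (stage R a r b 1).2)
  rw [H.rel] at hrel
  have hne : σ.oldSide ≠ [] := by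
    intro h
    rw [h] at hrel
    rcases hrel with h | h
    · exact H.left_ne h.1.symm
    · exact H.right_ne h.1.symm
  have hr := List.length_pos_iff.2 H.left_ne
  have key : label σ.oldSide ≠ r → label σ.oldSide = t ∧ σ.newLabel = r :=
    fun h => hrel.resolve_left fun h' => h h'.1
  rcases hint with ⟨k, hk, hk', hp⟩ | ⟨k, hk, hk', hp⟩
  all_goals
    rw [hl] at hk'
    rw [hs, ht, hl] at hp
    have hp' := hp.trans (sewnVertex_interior hk hk')
  · obtain ⟨hlab, hnew⟩ : label σ.oldSide = t ∧ σ.newLabel = r := by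
      refine key fun h => ?_
      obtain ⟨e, hel, he, hes⟩ := hseg.exists_first hne
      have h' := (stage_one_of_src_inner H he (hes.trans hp')).2
      exact H.disj e.lbl (h ▸ lbl_mem_label hel) (List.mem_of_getElem? h')
    refine ⟨hnew, k, .inl ⟨hk, hk', hp', ?_⟩⟩
    -- From the `k`-th vertex, `t.length - k` edges lead to the end of the `t`-path; the old side is
    -- cut there.
    have hlen : σ.oldSide.length = t.length := by rw [← length_label, hlab]
    rw [hp, ← List.take_append_drop (t.length - k) σ.oldSide] at hseg
    obtain ⟨m, h₁, h₂⟩ := isSegment_append.1 hseg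
    have hlen₁ : (σ.oldSide.take (t.length - k)).length = t.length - k := by
      rw [List.length_take]; omega
    have hf : ∀ i, k ≤ i → i < k + (σ.oldSide.take (t.length - k)).length →
        ∀ e ∈ (stage R a r b 1).1,
        e.src = sewnVertex (.base a.length) (.base (a.length + r.length)) t i →
        e.tgt = sewnVertex (.base a.length) (.base (a.length + r.length)) t (i + 1) ∧
          t[i]? = some e.lbl := by
      intro i hi hi' e he hes
      rw [hlen₁] at hi'
      exact stage_one_of_src_inner H he (hes.trans (sewnVertex_interior (by omega) (by omega)))
    have hm := h₁.follow fun i hi hi' e he hes => (hf i hi hi' e he hes).1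
    have hpre := h₁.label_prefix hf
    rw [hlen₁, Nat.add_sub_of_le hk'.le, sewnVertex_length H.right_ne] at hm
    have heq := hpre.eq_of_length (by rw [length_label, hlen₁, List.length_drop])
    constructor
    · rw [hm] at h₂
      have := h₂.follow (f := fun i => .base (a.length + r.length + i)) (i := 0)
        fun i _ _ e he hes => stage_one_of_src_base H he
          (j := a.length + r.length + i) (by omega) hes
      exact ⟨_, Nat.le_add_right _ _, this⟩
    · refine ⟨label (σ.oldSide.drop (t.length - k)), ?_⟩
      rw [← heq, ← label_append, List.take_append_drop, hlab]
  -- Mirror image, reading backwards; the facts about entering edges are stated for target index `k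
  -- + 1`.
  · obtain ⟨k, rfl⟩ : ∃ i, k = i + 1 := ⟨k - 1, by omega⟩
    obtain ⟨hlab, hnew⟩ : label σ.oldSide = t ∧ σ.newLabel = r := by
      refine key fun h => ?_
      obtain ⟨e, hel, he, hes⟩ := hseg.exists_last hne
      have h' := (stage_one_of_tgt_inner H he (hes.trans hp')).2
      exact H.disj e.lbl (h ▸ lbl_mem_label hel) (List.mem_of_getElem? h')
    refine ⟨hnew, k + 1, .inr ⟨hk, hk', hp', ?_⟩⟩
    have hlen : σ.oldSide.length = t.length := by rw [← length_label, hlab]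
    rw [hp, ← List.take_append_drop (t.length - (k + 1)) σ.oldSide] at hseg
    obtain ⟨m, h₁, h₂⟩ := isSegment_append.1 hseg
    have hlen₂ : (σ.oldSide.drop (t.length - (k + 1))).length = k + 1 := by
      rw [List.length_drop]; omega
    have hf : ∀ i, 0 ≤ i → i < 0 + (σ.oldSide.drop (t.length - (k + 1))).length →
        ∀ e ∈ (stage R a r b 1).1,
        e.tgt = sewnVertex (.base a.length) (.base (a.length + r.length)) t (i + 1) →
        e.src = sewnVertex (.base a.length) (.base (a.length + r.length)) t i ∧
          t[i]? = some e.lbl := by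
      intro i _ hi' e he hes
      rw [hlen₂] at hi'
      exact stage_one_of_tgt_inner H he (hes.trans (sewnVertex_interior (by omega) (by omega)))
    have h₂' : IsSegment (stage R a r b 1).1 m (σ.oldSide.drop (t.length - (k + 1)))
        (sewnVertex (.base a.length) (.base (a.length + r.length)) t
          (0 + (σ.oldSide.drop (t.length - (k + 1))).length)) := by
      rwa [hlen₂, zero_add]
    have hm := h₂'.follow_back fun i hi hi' e he hes => (hf i hi hi' e he hes).1
    have hsuf := h₂'.label_suffix hf
    rw [sewnVertex_zero] at hm
    rw [hlen₂, zero_add] at hsuf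
    have heq := hsuf.eq_of_length (by rw [length_label, hlen₂, List.length_take]; omega)
    constructor
    · rw [hm] at h₁
      obtain ⟨i, hi, h⟩ := exists_src_base_of_tgt_base H (by omega) h₁
      exact ⟨i, by omega, h⟩
    · refine ⟨label (σ.oldSide.take (t.length - (k + 1))), ?_⟩
      rw [← heq, ← label_append, List.take_append_drop, hlab]

/-! ### The graph after the second step -/

lemma mem_stage_two_edges (H : IsDisjointPair R r t) {e : Edge X}
    (he : e ∈ (stage R a r b 2).1) :
    e ∈ linearGraph (a ++ r ++ b) ∨
      (∃ (k : ℕ) (h : k < t.length),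
        e = ⟨sewnVertex (.base a.length) (.base (a.length + r.length)) t k, t[k],
          sewnVertex (.base a.length) (.base (a.length + r.length)) t (k + 1)⟩) ∨
      ∃ σ ∈ (stage R a r b 2).2, ∃ (k : ℕ) (h : k < r.length),
        e = ⟨sewnVertex σ.src σ.tgt r k, r[k], sewnVertex σ.src σ.tgt r (k + 1)⟩ := by
  rcases he with he | ⟨σ, hσ, he⟩
  · exact (mem_stage_one_edges H he).imp_right .inl
  · obtain ⟨k, hk, rfl⟩ := he
    have hl := (mem_stage_two H (hσ : σ ∈ (stage R a r b 2).2)).1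
    obtain ⟨p, q, o, n⟩ := σ
    subst hl
    exact .inr (.inr ⟨_, hσ, k, hk, rfl⟩)

/-- Second-step paths are attached at vertices of the automaton or of the `t`-path, so none branches
off inside another one. -/
lemma src_ne_inner (H : IsDisjointPair R r t) {σ : Region X} (hσ : σ ∈ (stage R a r b 2).2)
    (p q : Vertex X) (k : ℕ) : σ.src ≠ .inner p q r k := by
  obtain ⟨-, k', h | h⟩ := mem_stage_two H hσ
  · rw [h.2.2.1]
    intro h'
    exact H.right_ne_left (Vertex.inner.inj h').2.2.1
  · obtain ⟨j, -, hj⟩ := h.2.2.2.1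
    rw [hj]
    simp

lemma tgt_ne_inner (H : IsDisjointPair R r t) {σ : Region X} (hσ : σ ∈ (stage R a r b 2).2)
    (p q : Vertex X) (k : ℕ) : σ.tgt ≠ .inner p q r k := by
  obtain ⟨-, k', h | h⟩ := mem_stage_two H hσ
  · obtain ⟨j, -, hj⟩ := h.2.2.2.1
    rw [hj]
    simp
  · rw [h.2.2.1]
    intro h'
    exact H.right_ne_left (Vertex.inner.inj h').2.2.1

lemma stage_two_of_src_inner (H : IsDisjointPair R r t) {e : Edge X}
    (he : e ∈ (stage R a r b 2).1) {p q : Vertex X} {k : ℕ} (hs : e.src = .inner p q r k) :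
    e.tgt = sewnVertex p q r (k + 1) ∧ r[k]? = some e.lbl := by
  rcases mem_stage_two_edges H he with ⟨j, hj, rfl⟩ | ⟨j, hj, rfl⟩ | ⟨σ, hσ, j, hj, rfl⟩
  · cases hs
  · rcases sewnVertex_source_cases (p := .base a.length) (q := .base (a.length + r.length)) hj with
      ⟨-, h⟩ | ⟨-, h⟩
    · cases h.symm.trans hs
    · exact absurd (Vertex.inner.inj (h.symm.trans hs)).2.2.1 H.right_ne_left
  · rcases sewnVertex_source_cases (p := σ.src) (q := σ.tgt) hj with ⟨-, h⟩ | ⟨-, h⟩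
    · exact absurd (h.symm.trans hs) (src_ne_inner H hσ _ _ _)
    · cases h.symm.trans hs
      exact ⟨rfl, List.getElem?_eq_getElem hj⟩

lemma stage_two_of_tgt_inner (H : IsDisjointPair R r t) {e : Edge X}
    (he : e ∈ (stage R a r b 2).1) {p q : Vertex X} {k : ℕ}
    (hs : e.tgt = .inner p q r (k + 1)) :
    e.src = sewnVertex p q r k ∧ r[k]? = some e.lbl := by
  rcases mem_stage_two_edges H he with ⟨j, hj, rfl⟩ | ⟨j, hj, rfl⟩ | ⟨σ, hσ, j, hj, rfl⟩
  · cases hs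
  · rcases sewnVertex_target_cases (p := .base a.length) (q := .base (a.length + r.length)) hj with
      ⟨-, h⟩ | ⟨-, h⟩
    · cases h.symm.trans hs
    · exact absurd (Vertex.inner.inj (h.symm.trans hs)).2.2.1 H.right_ne_left
  · rcases sewnVertex_target_cases (p := σ.src) (q := σ.tgt) hj with ⟨-, h⟩ | ⟨-, h⟩
    · exact absurd (h.symm.trans hs) (tgt_ne_inner H hσ _ _ _)
    · cases h.symm.trans hs
      exact ⟨rfl, List.getElem?_eq_getElem hj⟩

/-- The edges of the `t`-path itself carry letters of `t`, so a letter of `r` can only begin a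
second-step path. -/
lemma exists_region_of_src (H : IsDisjointPair R r t) {e : Edge X}
    (he : e ∈ (stage R a r b 2).1) (hl : e.lbl ∈ r) {p q : Vertex X} {k : ℕ}
    (hs : e.src = .inner p q t k) :
    ∃ σ ∈ (stage R a r b 2).2, σ.src = .inner p q t k ∧
      e.tgt = sewnVertex σ.src σ.tgt r 1 ∧ r[0]? = some e.lbl := by
  rcases mem_stage_two_edges H he with ⟨j, hj, rfl⟩ | ⟨j, hj, rfl⟩ | ⟨σ, hσ, j, hj, rfl⟩
  · cases hs
  · exact absurd (List.getElem_mem hj) (H.disj _ hl)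
  · rcases sewnVertex_source_cases (p := σ.src) (q := σ.tgt) hj with ⟨rfl, h⟩ | ⟨-, h⟩
    · exact ⟨σ, hσ, h.symm.trans hs, rfl, List.getElem?_eq_getElem hj⟩
    · exact absurd (Vertex.inner.inj (h.symm.trans hs)).2.2.1 H.ne

lemma exists_region_of_tgt (H : IsDisjointPair R r t) {e : Edge X}
    (he : e ∈ (stage R a r b 2).1) (hl : e.lbl ∈ r) {p q : Vertex X} {k : ℕ}
    (hs : e.tgt = .inner p q t k) :
    ∃ σ ∈ (stage R a r b 2).2, σ.tgt = .inner p q t k ∧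
      ∃ j, j + 1 = r.length ∧ e.src = sewnVertex σ.src σ.tgt r j ∧ r[j]? = some e.lbl := by
  rcases mem_stage_two_edges H he with ⟨j, hj, rfl⟩ | ⟨j, hj, rfl⟩ | ⟨σ, hσ, j, hj, rfl⟩
  · cases hs
  · exact absurd (List.getElem_mem hj) (H.disj _ hl)
  · rcases sewnVertex_target_cases (p := σ.src) (q := σ.tgt) hj with ⟨hj', h⟩ | ⟨-, h⟩
    · exact ⟨σ, hσ, h.symm.trans hs, j, hj', rfl, List.getElem?_eq_getElem hj⟩
    · exact absurd (Vertex.inner.inj (h.symm.trans hs)).2.2.1 H.ne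

/-- Sewn-on paths leave the linear automaton only at or before `base a.length`: the `t`-path and the
left regions start there, and right regions start off the automaton. -/
lemma mem_linearGraph_of_src_base (H : IsDisjointPair R r t) {e : Edge X}
    (he : e ∈ (stage R a r b 2).1) {j : ℕ} (hj : a.length + r.length ≤ j)
    (hs : e.src = .base j) : e ∈ linearGraph (a ++ r ++ b) := by
  have hr := List.length_pos_iff.2 H.left_ne
  rcases mem_stage_two_edges H he with h | ⟨i, hi, rfl⟩ | ⟨σ, hσ, i, hi, rfl⟩
  · exact h
  · rcases sewnVertex_source_cases (p := .base a.length) (q := .base (a.length + r.length)) hi with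
      ⟨-, h⟩ | ⟨-, h⟩
    · cases h.symm.trans hs; omega
    · cases h.symm.trans hs
  · rcases sewnVertex_source_cases (p := σ.src) (q := σ.tgt) hi with ⟨-, h⟩ | ⟨-, h⟩
    · have h := h.symm.trans hs
      obtain ⟨-, k', h' | h'⟩ := mem_stage_two H hσ
      · cases h'.2.2.1.symm.trans h
      · obtain ⟨i', hi', h'⟩ := h'.2.2.2.1
        cases h'.symm.trans h
        omega
    · cases h.symm.trans hs

lemma mem_linearGraph_of_tgt_base (H : IsDisjointPair R r t) {e : Edge X}
    (he : e ∈ (stage R a r b 2).1) {j : ℕ} (hj : j ≤ a.length)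
    (hs : e.tgt = .base j) : e ∈ linearGraph (a ++ r ++ b) := by
  have hr := List.length_pos_iff.2 H.left_ne
  rcases mem_stage_two_edges H he with h | ⟨i, hi, rfl⟩ | ⟨σ, hσ, i, hi, rfl⟩
  · exact h
  · rcases sewnVertex_target_cases (p := .base a.length) (q := .base (a.length + r.length)) hi with
      ⟨-, h⟩ | ⟨-, h⟩
    · cases h.symm.trans hs; omega
    · cases h.symm.trans hs
  · rcases sewnVertex_target_cases (p := σ.src) (q := σ.tgt) hi with ⟨-, h⟩ | ⟨-, h⟩
    · have h := h.symm.trans hs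
      obtain ⟨-, k', h' | h'⟩ := mem_stage_two H hσ
      · obtain ⟨i', hi', h'⟩ := h'.2.2.2.1
        cases h'.symm.trans h
        omega
      · cases h'.2.2.1.symm.trans h
    · cases h.symm.trans hs

lemma IsSegment.label_prefix_sewn (H : IsDisjointPair R r t) {p q q' : Vertex X} {k : ℕ}
    {l : List (Edge X)} (hl : IsSegment (stage R a r b 2).1 (sewnVertex p q r k) l q')
    (hk : 0 < k) (hlen : k + l.length ≤ r.length) :
    q' = sewnVertex p q r (k + l.length) ∧ label l <+: r.drop k := by
  have hf : ∀ i, k ≤ i → i < k + l.length → ∀ e ∈ (stage R a r b 2).1,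
      e.src = sewnVertex p q r i → e.tgt = sewnVertex p q r (i + 1) ∧ r[i]? = some e.lbl :=
    fun i hi hi' e he hes => stage_two_of_src_inner H he
      (hes.trans (sewnVertex_interior (by omega) (by omega)))
  exact ⟨hl.follow fun i hi hi' e he hes => (hf i hi hi' e he hes).1, hl.label_prefix hf⟩

lemma IsSegment.label_suffix_sewn (H : IsDisjointPair R r t) {p q p' : Vertex X} {k : ℕ}
    {l : List (Edge X)}
    (hl : IsSegment (stage R a r b 2).1 p' l (sewnVertex p q r (k + l.length)))
    (hlen : k + l.length < r.length) :
    p' = sewnVertex p q r k ∧ label l <:+ r.take (k + l.length) := by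
  have hf : ∀ i, k ≤ i → i < k + l.length → ∀ e ∈ (stage R a r b 2).1,
      e.tgt = sewnVertex p q r (i + 1) → e.src = sewnVertex p q r i ∧ r[i]? = some e.lbl :=
    fun i hi hi' e he hes => stage_two_of_tgt_inner H he
      (hes.trans (sewnVertex_interior (by omega) (by omega)))
  exact ⟨hl.follow_back fun i hi hi' e he hes => (hf i hi hi' e he hes).1, hl.label_suffix hf⟩

/-- A segment with label in `r` that starts on the segment sewn on at the first step follows a
segment sewn on at the second step. -/
lemma IsSegment.label_prefix_of_src_inner (H : IsDisjointPair R r t) {p q q' : Vertex X} {k : ℕ}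
    {l : List (Edge X)} (hl : IsSegment (stage R a r b 2).1 (.inner p q t k) l q') (hne : l ≠ [])
    (hlab : label l ⊆ r) (hlen : l.length ≤ r.length) :
    (∃ σ ∈ (stage R a r b 2).2, σ.src = .inner p q t k) ∧ label l <+: r := by
  cases l with
  | nil => exact absurd rfl hne
  | cons e l =>
    obtain ⟨he, hs, hl⟩ := hl
    rw [List.length_cons] at hlen
    obtain ⟨σ, hσ, hσs, ht, h0⟩ :=
      exists_region_of_src H he (hlab (lbl_mem_label List.mem_cons_self)) hs
    rw [ht] at hl
    have hpre := (hl.label_prefix_sewn H one_pos (by omega)).2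
    obtain ⟨h, h0⟩ := List.getElem?_eq_some_iff.1 h0
    refine ⟨⟨σ, hσ, hσs⟩, ?_⟩
    rw [← List.drop_zero (l := r), List.drop_eq_getElem_cons h, h0]
    exact (List.prefix_cons_inj _).2 hpre

/-- A segment with label in `r` that ends on the segment sewn on at the first step follows a
segment sewn on at the second step. -/
lemma IsSegment.label_suffix_of_tgt_inner (H : IsDisjointPair R r t) {p q p' : Vertex X} {k : ℕ}
    {l : List (Edge X)} (hl : IsSegment (stage R a r b 2).1 p' l (.inner p q t k)) (hne : l ≠ [])
    (hlab : label l ⊆ r) (hlen : l.length ≤ r.length) :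
    (∃ σ ∈ (stage R a r b 2).2, σ.tgt = .inner p q t k) ∧ label l <:+ r := by
  obtain ⟨l, e, rfl⟩ := (List.eq_nil_or_concat' l).resolve_left hne
  obtain ⟨m, hl, he, hs, ht⟩ := isSegment_append.1 hl
  rw [List.length_append, List.length_singleton] at hlen
  obtain ⟨σ, hσ, hσt, j, hj, hs', h0⟩ :=
    exists_region_of_tgt H he (hlab (lbl_mem_label (by simp))) ht
  obtain ⟨i, rfl⟩ : ∃ i, j = i + l.length := ⟨j - l.length, by omega⟩
  rw [← hs, hs'] at hl
  obtain ⟨c, hc⟩ := (hl.label_suffix_sewn H (by omega)).2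
  refine ⟨⟨σ, hσ, hσt⟩, c, ?_⟩
  rw [label_append, ← List.append_assoc, hc]
  conv_rhs => rw [← List.take_length (l := r), ← hj, List.take_add_one, h0]
  rfl

/-! ### Special regions and commuting factors -/

lemma hasCommutingFactors_of_isSpecialRegion (H : IsDisjointPair R r t) {ρ : Region X}
    (hρ : IsSpecialRegion R a r b ρ) : HasCommutingFactors r ∧ HasCommutingFactors t := by
  obtain ⟨⟨hgen, -⟩, hdisj⟩ := hρ
  have hold : ∀ e ∈ ρ.oldSide, e ∉ linearGraph (a ++ r ++ b) := fun e he =>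
    Set.disjoint_left.1 hdisj (.inl he)
  obtain ⟨⟨hseg, hrel, -⟩, σ, hσ, hint⟩ := hgen
  have hseg : IsSegment (stage R a r b 2).1 ρ.src ρ.oldSide ρ.tgt := hseg
  have hσ : σ ∈ (stage R a r b 2).2 := hσ
  obtain ⟨hnew, c, hc⟩ := mem_stage_two H hσ
  rw [H.rel] at hrel
  have hne : ρ.oldSide ≠ [] := by
    intro h
    rw [h] at hrel
    rcases hrel with h | h
    · exact H.left_ne h.1.symm
    · exact H.right_ne h.1.symm
  have key : label ρ.oldSide ≠ t → label ρ.oldSide = r := fun h =>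
    (hrel.resolve_right fun h' => h h'.1).1
  rcases hint with ⟨k, hk, hk', hp⟩ | ⟨k, hk, hk', hp⟩
  all_goals
    rw [hnew] at hk' hp
    have hp' := hp.trans (sewnVertex_interior hk hk')
  · have hlab : label ρ.oldSide = r := by
      refine key fun h => ?_
      obtain ⟨e, hel, he, hes⟩ := hseg.exists_first hne
      exact H.disj e.lbl (List.mem_of_getElem? (stage_two_of_src_inner H he (hes.trans hp')).2)
        (h ▸ lbl_mem_label hel)
    have hlen : ρ.oldSide.length = r.length := by rw [← length_label, hlab]
    obtain ⟨l₁, l₂, hl, hlen₁⟩ : ∃ l₁ l₂, ρ.oldSide = l₁ ++ l₂ ∧ l₁.length = r.length - k :=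
      ⟨_, _, (List.take_append_drop (r.length - k) _).symm, by rw [List.length_take]; omega⟩
    rw [hl] at hseg hold hlab
    rw [hl, List.length_append] at hlen
    rw [label_append] at hlab
    rw [hp] at hseg
    obtain ⟨m, h₁, h₂⟩ := isSegment_append.1 hseg
    obtain ⟨hm, hpre⟩ := h₁.label_prefix_sewn H hk (by omega)
    rw [hlen₁, Nat.add_sub_of_le hk'.le, sewnVertex_length H.left_ne] at hm
    have heq := hpre.eq_of_length (by rw [length_label, hlen₁, List.length_drop])
    have hne₂ : l₂ ≠ [] := by rw [← List.length_pos_iff]; omega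
    rw [hm] at h₂
    -- If `σ` is a right region, the next edge of the old side lies on the linear automaton, a
    -- contradiction. If `σ` is a left region, the old side continues on a right region `τ` starting
    -- where `σ` ends.
    rcases hc with hc | hc
    · obtain ⟨j, hj, hj'⟩ := hc.2.2.2.1
      obtain ⟨e, hel, he, hes⟩ := h₂.exists_first hne₂
      exact absurd (mem_linearGraph_of_src_base H he hj (hes.trans hj'))
        (hold e (List.mem_append_right _ hel))
    · rw [hc.2.2.1] at h₂
      obtain ⟨⟨τ, hτ, hτs⟩, hpre₂⟩ := h₂.label_prefix_of_src_inner H hne₂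
        (fun x hx => hlab ▸ List.mem_append_right _ hx) (by omega)
      obtain ⟨-, d, hd | hd⟩ := mem_stage_two H hτ
      · cases hd.2.2.1.symm.trans hτs
        -- For `t`, the common vertex of `σ` and `τ` is the cut: `τ` gives the prefix condition and
        -- `σ` the suffix condition. For `r`, the old side reads `r.drop k` on `σ` and `r.take k` on
        -- `τ`.
        refine ⟨hasCommutingFactors_of_drop_prefix hk hk' ?_ ?_,
          hasCommutingFactors_of_drop_prefix hd.1 hd.2.1 hd.2.2.2.2 hc.2.2.2.2⟩
        · exact ⟨label l₂, by rw [← heq, hlab]⟩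
        · refine ⟨label l₁, ?_⟩
          have := List.prefix_iff_eq_take.1 hpre₂
          rw [length_label, show l₂.length = k by omega] at this
          rw [← this, hlab]
      · obtain ⟨j, -, hj⟩ := hd.2.2.2.1
        cases hj.symm.trans hτs
  · obtain ⟨k, rfl⟩ : ∃ i, k = i + 1 := ⟨k - 1, by omega⟩
    have hlab : label ρ.oldSide = r := by
      refine key fun h => ?_
      obtain ⟨e, hel, he, hes⟩ := hseg.exists_last hne
      exact H.disj e.lbl (List.mem_of_getElem? (stage_two_of_tgt_inner H he (hes.trans hp')).2)
        (h ▸ lbl_mem_label hel)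
    have hlen : ρ.oldSide.length = r.length := by rw [← length_label, hlab]
    obtain ⟨l₁, l₂, hl, hlen₁⟩ : ∃ l₁ l₂, ρ.oldSide = l₁ ++ l₂ ∧
        l₁.length = r.length - (k + 1) :=
      ⟨_, _, (List.take_append_drop (r.length - (k + 1)) _).symm, by rw [List.length_take]; omega⟩
    rw [hl] at hseg hold hlab
    rw [hl, List.length_append] at hlen
    rw [label_append] at hlab
    have hlen₂ : l₂.length = k + 1 := by omega
    rw [hp, ← hlen₂, ← zero_add l₂.length] at hseg
    obtain ⟨m, h₁, h₂⟩ := isSegment_append.1 hseg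
    obtain ⟨hm, hsuf⟩ := h₂.label_suffix_sewn H (by omega)
    rw [sewnVertex_zero] at hm
    rw [hlen₂, zero_add] at hsuf
    have heq := hsuf.eq_of_length (by rw [length_label, hlen₂, List.length_take]; omega)
    have hne₁ : l₁ ≠ [] := by rw [← List.length_pos_iff]; omega
    rw [hm] at h₁
    -- The mirror image: now `σ` is the right region, and the old side arrives on a left region `τ`.
    rcases hc with hc | hc
    · rw [hc.2.2.1] at h₁
      obtain ⟨⟨τ, hτ, hτs⟩, hsuf₁⟩ := h₁.label_suffix_of_tgt_inner H hne₁
        (fun x hx => hlab ▸ List.mem_append_left _ hx) (by omega)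
      obtain ⟨-, d, hd | hd⟩ := mem_stage_two H hτ
      · obtain ⟨j, -, hj⟩ := hd.2.2.2.1
        cases hj.symm.trans hτs
      · cases hd.2.2.1.symm.trans hτs
        refine ⟨hasCommutingFactors_of_drop_prefix hk hk' ?_ ?_,
          hasCommutingFactors_of_drop_prefix hd.1 hd.2.1 hc.2.2.2.2 hd.2.2.2.2⟩
        · refine ⟨label l₂, ?_⟩
          have := List.suffix_iff_eq_drop.1 hsuf₁
          rw [length_label, show r.length - l₁.length = k + 1 by omega] at this
          rw [← this, hlab]
        · exact ⟨label l₁, by rw [← heq, hlab]⟩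
    · obtain ⟨j, hj, hj'⟩ := hc.2.2.2.1
      obtain ⟨e, hel, he, hes⟩ := h₁.exists_last hne₁
      exact absurd (mem_linearGraph_of_tgt_base H he hj (hes.trans hj'))
        (hold e (List.mem_append_left _ hel))

/-- If both words are products of commuting factors, a special region exists. -/
lemma exists_isSpecialRegion (H : IsDisjointPair R r t) (hr : HasCommutingFactors r)
    (ht : HasCommutingFactors t) : ∃ a b ρ, IsSpecialRegion R a r b ρ := by
  obtain ⟨x, x', hx, hx', hr, hr'⟩ := hr
  obtain ⟨y, y', hy, hy', ht, ht'⟩ := ht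
  rw [← List.length_pos_iff] at hx hx' hy hy'
  have hrl : r.length = x.length + x'.length := by rw [hr, List.length_append]
  have htl : t.length = y.length + y'.length := by rw [ht, List.length_append]
  -- The vertex `C` below splits the `t`-path into `y` and `y'`. With `y'` before `r` and `y` behind
  -- it, `y' ++ y = t` is readable both into `C` and out of `C`.
  set w := y' ++ r ++ y with hw
  have hwl : w.length = y'.length + r.length + y.length := by
    simp [hw, add_assoc]
  have hlin : ∀ (k : ℕ) (hk : k < w.length),
      (⟨.base k, w[k], .base (k + 1)⟩ : Edge X) ∈ linearGraph w := fun k hk => ⟨k, hk, rfl⟩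
  set A : Vertex X := .base y'.length with hA
  set B : Vertex X := .base (y'.length + r.length) with hB
  set C : Vertex X := .inner A B t y.length with hC
  have hC' : sewnVertex A B t y.length = C := sewnVertex_interior hy (by omega)
  -- the region of the first step
  obtain ⟨l, hl, hlab, -⟩ := exists_isSegment (E := linearGraph w) (f := .base) y'.length r.length
    (by omega) hlin
  have hlab : label l = r := by rw [hlab, hw]; simp
  have h₁ : (⟨A, B, l, t⟩ : Region X) ∈ (stage R y' r y 1).2 := by
    refine ⟨⟨hl, (H.rel _ _).2 (.inl ⟨hlab, rfl⟩), ?_⟩, rfl, rfl, hlab⟩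
    -- In the linear automaton the edge leaving `A` carries the first letter of `r`, which is not in
    -- `t`.
    rintro ⟨l', hl', hlab'⟩
    obtain ⟨e, hel, ⟨k, hk, rfl⟩, hes⟩ := hl'.exists_first (by
      rintro rfl; exact H.right_ne hlab'.symm)
    have hk' : k = y'.length := by simpa [hA] using hes
    subst hk'
    refine H.disj _ ?_ (hlab' ▸ lbl_mem_label hel)
    have : 0 < r.length := by omega
    simp [this]
  have hE₀ : linearGraph w ⊆ (stage R y' r y 1).1 := Set.subset_union_left
  have hE₁ : (stage R y' r y 1).1 ⊆ (stage R y' r y 2).1 := Set.subset_union_left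
  have hpath₁ : ∀ (k : ℕ) (hk : k < t.length),
      (⟨sewnVertex A B t k, t[k], sewnVertex A B t (k + 1)⟩ : Edge X) ∈ (stage R y' r y 1).1 :=
    fun k hk => .inr ⟨_, h₁, k, hk, rfl⟩
  have hCint : C ∈ (⟨A, B, l, t⟩ : Region X).newInterior :=
    ⟨y.length, hy, show y.length < t.length by omega, hC'.symm⟩
  -- the right region of the second step
  obtain ⟨l₁, hl₁, hlab₁, -⟩ := exists_isSegment y.length y'.length (by omega) hpath₁
  obtain ⟨l₂, hl₂, hlab₂, -⟩ := exists_isSegment (E := linearGraph w) (f := .base)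
    (y'.length + r.length) y.length (by omega) hlin
  have hlab₁ : label l₁ = y' := by rw [hlab₁, ht]; simp
  have hlab₂ : label l₂ = y := by rw [hlab₂, hw]; simp
  rw [← htl, sewnVertex_length H.right_ne, hC'] at hl₁
  set D : Vertex X := .base (y'.length + r.length + y.length) with hD
  have hright : (⟨C, D, l₁ ++ l₂, r⟩ : Region X) ∈ (stage R y' r y 2).2 := by
    refine ⟨⟨isSegment_append.2 ⟨_, hl₁, hl₂.mono hE₀⟩, (H.rel _ _).2 (.inr ⟨?_, rfl⟩), ?_⟩,
      _, h₁, .inl hCint⟩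
    · rw [label_append, hlab₁, hlab₂, ht']
    · rintro ⟨l', hl', (hlab' : label l' = r)⟩
      obtain ⟨e, hel, he, hes⟩ := hl'.exists_first (by rintro rfl; exact H.left_ne hlab'.symm)
      exact H.disj e.lbl (hlab' ▸ lbl_mem_label hel)
        (List.mem_of_getElem? (stage_one_of_src_inner H he hes).2)
  -- the left region of the second step
  obtain ⟨l₃, hl₃, hlab₃, -⟩ := exists_isSegment (E := linearGraph w) (f := .base)
    0 y'.length (by omega) hlin
  obtain ⟨l₄, hl₄, hlab₄, -⟩ := exists_isSegment 0 y.length (by omega) hpath₁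
  have hlab₃ : label l₃ = y' := by rw [hlab₃, hw]; simp
  have hlab₄ : label l₄ = y := by rw [hlab₄, ht]; simp
  rw [zero_add, hC', sewnVertex_zero] at hl₄
  rw [zero_add] at hl₃
  have hleft : (⟨.base 0, C, l₃ ++ l₄, r⟩ : Region X) ∈ (stage R y' r y 2).2 := by
    refine ⟨⟨isSegment_append.2 ⟨_, hl₃.mono hE₀, hl₄⟩, (H.rel _ _).2 (.inr ⟨?_, rfl⟩), ?_⟩,
      _, h₁, .inr hCint⟩
    · rw [label_append, hlab₃, hlab₄, ht']
    · rintro ⟨l', hl', (hlab' : label l' = r)⟩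
      obtain ⟨e, hel, he, hes⟩ := hl'.exists_last (by rintro rfl; exact H.left_ne hlab'.symm)
      obtain ⟨i, hi⟩ : ∃ i, y.length = i + 1 := ⟨y.length - 1, by omega⟩
      rw [hC, hi] at hes
      exact H.disj e.lbl (hlab' ▸ lbl_mem_label hel)
        (List.mem_of_getElem? (stage_one_of_tgt_inner H he hes).2)
  -- the special region
  have hpathL : ∀ (k : ℕ) (hk : k < r.length),
      (⟨sewnVertex (.base 0) C r k, r[k], sewnVertex (.base 0) C r (k + 1)⟩ : Edge X) ∈
        (stage R y' r y 2).1 := fun k hk => .inr ⟨_, hleft, k, hk, rfl⟩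
  have hpathR : ∀ (k : ℕ) (hk : k < r.length),
      (⟨sewnVertex C D r k, r[k], sewnVertex C D r (k + 1)⟩ : Edge X) ∈
        (stage R y' r y 2).1 := fun k hk => .inr ⟨_, hright, k, hk, rfl⟩
  obtain ⟨l₅, hl₅, hlab₅, hsrc₅⟩ := exists_isSegment x.length x'.length (by omega) hpathL
  obtain ⟨l₆, hl₆, hlab₆, hsrc₆⟩ := exists_isSegment 0 x.length (by omega) hpathR
  have hlab₅ : label l₅ = x' := by rw [hlab₅, hr]; simp
  have hlab₆ : label l₆ = x := by rw [hlab₆, hr]; simp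
  rw [← hrl, sewnVertex_length H.left_ne] at hl₅
  rw [zero_add, sewnVertex_zero] at hl₆
  have hxr : x.length < r.length := by omega
  -- From position `x.length` of the left `r`-path, `x'` leads to `C` and `x` continues on the right
  -- `r`-path; together they spell `x' ++ x = r`.
  have hρ : (⟨sewnVertex (.base 0) C r x.length, sewnVertex C D r x.length, l₅ ++ l₆, t⟩ :
      Region X) ∈ (stage R y' r y 3).2 := by
    refine ⟨⟨isSegment_append.2 ⟨_, hl₅, hl₆⟩, (H.rel _ _).2 (.inl ⟨?_, rfl⟩), ?_⟩,
      _, hleft, .inl ⟨x.length, hx, hxr, rfl⟩⟩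
    · rw [label_append, hlab₅, hlab₆, hr']
    · rintro ⟨l', hl', (hlab' : label l' = t)⟩
      obtain ⟨e, hel, he, hes⟩ := hl'.exists_first (by rintro rfl; exact H.right_ne hlab'.symm)
      exact H.disj e.lbl (List.mem_of_getElem?
        (stage_two_of_src_inner H he (hes.trans (sewnVertex_interior hx hxr))).2)
        (hlab' ▸ lbl_mem_label hel)
  refine ⟨y', y, _, ⟨hρ, ?_⟩, ?_⟩
  · rintro e (he | he)
    · exact Set.mem_iUnion.2 ⟨2, (isSegment_append.2 ⟨_, hl₅, hl₆⟩).mem he⟩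
    · exact Set.mem_iUnion.2 ⟨3, .inr ⟨_, hρ, he⟩⟩
  -- Every edge of the automaton has a `base` source, whereas every boundary edge starts at an
  -- `inner` vertex.
  · rw [Set.disjoint_left]
    rintro e (he | ⟨k, hk, rfl⟩) ⟨j, hj, hje⟩
    · have hes : e.src = .base j := by rw [hje]
      rcases List.mem_append.1 he with he | he
      · obtain ⟨k, hk, hk', h⟩ := hsrc₅ e he
        cases (h.trans (sewnVertex_interior (by omega) (by omega))).symm.trans hes
      · obtain ⟨k, -, hk, h⟩ := hsrc₆ e he
        rcases sewnVertex_source_cases (p := C) (q := D) (show k < r.length by omega) with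
          ⟨-, h'⟩ | ⟨-, h'⟩
        · cases ((h.trans h').trans hC).symm.trans hes
        · cases (h.trans h').symm.trans hes
    · have hes := congrArg Edge.src hje
      rcases sewnVertex_source_cases (p := sewnVertex (.base 0) C r x.length)
        (q := sewnVertex C D r x.length) hk with ⟨-, h'⟩ | ⟨-, h'⟩
      · cases (h'.trans (sewnVertex_interior hx hxr)).symm.trans hes
      · cases h'.symm.trans hes

end Stages

/-! ### Disjoint alphabets from type (2a) -/

lemma SelfOverlaps.two_le_length {s : List X} (hs : SelfOverlaps s) : 2 ≤ s.length := by
  obtain ⟨p, hp, hps, hpre, -⟩ := hs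
  have := List.length_pos_iff.2 hp
  have := hpre.length_le
  have : p.length ≠ s.length := fun h => hps (hpre.eq_of_length h)
  omega

lemma isProperSubword_singleton {s : List X} (hs : 2 ≤ s.length) {x : X} (hx : x ∈ s) :
    IsProperSubword [x] s := by
  refine ⟨by simp, ?_, ?_⟩
  · rintro rfl; simp at hs
  · obtain ⟨c, d, rfl⟩ := List.append_of_mem hx
    exact ⟨c, d, by simp⟩

/-- The two words of a presentation of type (2a) have no letter in common. -/
lemma IsType2a.isDisjointPair {u v : List X} (h : IsType2a u v) :
    IsDisjointPair {((u, v) : List X × List X)} u v where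
  rel p q := by simp [IsRelation]; tauto
  disj x hx hx' := h.no_common [x]
    ⟨isProperSubword_singleton h.self_left.two_le_length hx,
      isProperSubword_singleton h.self_right.two_le_length hx'⟩
  left_ne := by
    rintro rfl
    simpa using h.self_left.two_le_length
  right_ne := by
    rintro rfl
    simpa using h.self_right.two_le_length

end RWordGraph

theorem propositionP6 {X : Type*} (u v : List X)
    (hAdian : RWordGraph.IsAdian {((u, v) : List X × List X)})
    (hType : RWordGraph.IsType2a u v) :
    (∃ (w a r b : List X) (ρ : RWordGraph.Region X),
        w = a ++ r ++ b ∧ RWordGraph.IsRWord {((u, v) : List X × List X)} r ∧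
          RWordGraph.IsSpecialRegion {((u, v) : List X × List X)} a r b ρ) ↔
      ∃ (x y : List X) (n m : ℕ), x ≠ [] ∧ y ≠ [] ∧ 2 ≤ n ∧ 2 ≤ m ∧
        u = RWordGraph.wordPow x n ∧ v = RWordGraph.wordPow y m := by
  have H := hType.isDisjointPair
  have hpow : (∃ (x y : List X) (n m : ℕ), x ≠ [] ∧ y ≠ [] ∧ 2 ≤ n ∧ 2 ≤ m ∧
      u = RWordGraph.wordPow x n ∧ v = RWordGraph.wordPow y m) ↔
      RWordGraph.HasCommutingFactors u ∧ RWordGraph.HasCommutingFactors v := by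
    rw [RWordGraph.hasCommutingFactors_iff, RWordGraph.hasCommutingFactors_iff]
    constructor
    · rintro ⟨x, y, n, m, hx, hy, hn, hm, hu, hv⟩
      exact ⟨⟨x, n, hx, hn, hu⟩, y, m, hy, hm, hv⟩
    · rintro ⟨⟨x, n, hx, hn, hu⟩, y, m, hy, hm, hv⟩
      exact ⟨x, y, n, m, hx, hy, hn, hm, hu, hv⟩
  rw [hpow]
  constructor
  · rintro ⟨-, a, r, b, ρ, -, ⟨s, hs⟩, hρ⟩
    -- The displayed occurrence may be of either word; the argument is symmetric in the two.
    rcases (H.rel r s).1 hs with ⟨rfl, -⟩ | ⟨rfl, -⟩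
    · exact RWordGraph.hasCommutingFactors_of_isSpecialRegion H hρ
    · exact (RWordGraph.hasCommutingFactors_of_isSpecialRegion H.symm hρ).symm
  · rintro ⟨hu, hv⟩
    obtain ⟨a, b, ρ, hρ⟩ := RWordGraph.exists_isSpecialRegion H hu hv
    exact ⟨_, a, u, b, ρ, rfl, ⟨v, .inl rfl⟩, hρ⟩
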